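/- Let $\mathbb D$ be the open unit disc and let $m\ge 2$ be an integer. For a domain $D\subset\mathbb C$ (a non-empty connected open set) and distinct points $\lambda_1,\dots,\lambda_m\in\mathbb D$, a holomorphic function $f:\mathbb D\to D$ is called a weak $m$-extremal for $\lambda_1,\dots,\lambda_m$ if there is no function $h$, holomorphic in a neighborhood of $\overline{\mathbb D}$ with values in $D$, such that $h(\lambda_j)=f(\lambda_j)$ for $j=1,\dots,m$. It is called a weak $m$-extremal if this holds for some distinct $\lambda_1,\dots,\lambda_m\in\mathbb D$, and an $m$-extremal if this holds for all distinct $\lambda_1,\dots,\lambda_m\in\mathbb D$. A (finite) Blaschke product of degree $k\ge 0$ is a function $B(\lambda)=\zeta\prod_{j=1}^k\frac{\lambda-\alpha_j}{1-\overline{\alpha_j}\lambda}$, $\lambda\in\mathbb D$, with $|\zeta|=1$ and $\alpha_1,\dots,\alpha_k\in\mathbb D$. The domain $D$ is taut if every sequence of holomorphic functions $\mathbb D\to D$ has a subsequence that either converges locally uniformly on $\mathbb D$ to a holomorphic function $\mathbb D\to D$ or is compactly divergent, i.e. for all compact $K\subset\mathbb D$ and $L\subset D$ all but finitely many of its members $f_k$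 satisfy $f_k(K)\cap L=\emptyset$. Let $D\subset\mathbb C$ be a non-simply connected taut domain, let $\Pi:\mathbb D\to D$ be a holomorphic covering, and let $f:\mathbb D\to D$ be a holomorphic function. Then $f$ is a weak $m$-extremal if and only if $f=\Pi\circ B$ for some non-constant Blaschke product $B$ of degree at most $m-1$. Moreover, $f$ is not an $m$-extremal. -/

import Mathlib

open Set Filter Topology

namespace MExtremal

/-- The open unit disc. -/
abbrev disc : Set ℂ := Metric.ball (0 : ℂ) 1

/-- A domain in the plane: a nonempty connected open set. -/
def IsDomain (D : Set ℂ) : Prop := IsOpen D ∧ IsConnected D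

/-- `f` restricts to a holomorphic map from the open unit disc to `D`
(the values of `f` outside the disc play no role). -/
def HolDisc (D : Set ℂ) (f : ℂ → ℂ) : Prop := DifferentiableOn ℂ f disc ∧ MapsTo f disc D

/-- `h` is holomorphic in a neighborhood of the closed unit disc, with values in `D`. -/
def HolClosedDisc (D : Set ℂ) (h : ℂ → ℂ) : Prop :=
  ∃ U : Set ℂ, IsOpen U ∧ Metric.closedBall (0 : ℂ) 1 ⊆ U ∧
    DifferentiableOn ℂ h U ∧ MapsTo h U D

/-- Tautness: every sequence of holomorphic maps from the disc to `D` has a subsequence that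
either converges locally uniformly to a holomorphic map from the disc to `D`, or diverges
compactly. -/
def IsTaut (D : Set ℂ) : Prop :=
  ∀ F : ℕ → ℂ → ℂ, (∀ n, HolDisc D (F n)) →
    ∃ φ : ℕ → ℕ, StrictMono φ ∧
      ((∃ g, HolDisc D g ∧ TendstoLocallyUniformlyOn (fun n => F (φ n)) g atTop disc) ∨
        (∀ K L : Set ℂ, IsCompact K → K ⊆ disc → IsCompact L → L ⊆ D →
          ∀ᶠ n in atTop, Disjoint (F (φ n) '' K) L))

/-- `P` restricts to a holomorphic covering map from the unit disc onto `D`. -/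
def IsHolCovering (D : Set ℂ) (P : ℂ → ℂ) : Prop :=
  DifferentiableOn ℂ P disc ∧
    ∃ hP : MapsTo P disc D, IsCoveringMap (hP.restrict P disc D) ∧
      Function.Surjective (hP.restrict P disc D)

/-- The holomorphic map `f` from the disc to `D` is a weak `m`-extremal for the distinct points
`l 0, …, l (m - 1)` of the disc. -/
def IsWeakExtremalFor (D : Set ℂ) (f : ℂ → ℂ) {m : ℕ} (l : Fin m → ℂ) : Prop :=
  HolDisc D f ∧ ¬ ∃ h, HolClosedDisc D h ∧ ∀ j, h (l j) = f (l j)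

/-- `f` is a weak `m`-extremal of `D`: it is one for some distinct points of the disc. -/
def IsWeakExtremal (D : Set ℂ) (m : ℕ) (f : ℂ → ℂ) : Prop :=
  ∃ l : Fin m → ℂ, Function.Injective l ∧ (∀ j, l j ∈ disc) ∧ IsWeakExtremalFor D f l

/-- `f` is an `m`-extremal of `D`: it is a weak `m`-extremal for any distinct points of the
disc. -/
def IsExtremal (D : Set ℂ) (m : ℕ) (f : ℂ → ℂ) : Prop :=
  ∀ l : Fin m → ℂ, Function.Injective l → (∀ j, l j ∈ disc) → IsWeakExtremalFor D f l

/-- The Möbius function `m_a`. -/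
noncomputable def mobius (a z : ℂ) : ℂ := (z - a) / (1 - (starRingEnd ℂ) a * z)

/-- On the disc, `B` is a finite Blaschke product of degree `k`. -/
def IsBlaschkeProduct (k : ℕ) (B : ℂ → ℂ) : Prop :=
  ∃ (c : ℂ) (a : Fin k → ℂ), ‖c‖ = 1 ∧ (∀ j, a j ∈ disc) ∧
    ∀ z ∈ disc, B z = c * ∏ j, mobius (a j) z

/-- `B` is constant on the disc. -/
def IsConstOnDisc (B : ℂ → ℂ) : Prop := ∃ c : ℂ, ∀ z ∈ disc, B z = c

end MExtremal

/-! Everything is pulled back to the disc through the covering, where it becomes Nevanlinna–Pick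
interpolation. If `f` is a weak extremal, lift it to a self-map `g` of the disc. By the Schur
algorithm (`isBlaschkeProduct_or_exists_interpolation`) `g` is a Blaschke product of degree below
`m`, or a strict Schur function holomorphic across the circle interpolates it at the given points;
composed with `P`, the latter would be a forbidden competitor. Conversely, for `f = P ∘ B` take the
points so close to `0` that, by a Schwarz estimate, the lift of any competitor stays at these points
in a neighbourhood of `B 0` where `P` is injective. The lift then agrees with `B` at more points
than its degree, against `HolClosedDisc.not_eq_blaschkeProduct`. Finally `P` is not injective, and a
nontrivial deck transformation has no fixed point, so some fibre is infinite
(`IsHolCovering.infinite_fibre`). As `B` is onto the disc, `f` takes a single value at `m` suitable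
points, where a constant competes with it. -/

namespace MExtremal

open scoped ComplexConjugate

/-! ### Möbius functions of the disc -/

section Mobius

variable {a z : ℂ}

theorem norm_one_sub_conj_mul_sq (a z : ℂ) :
    ‖1 - conj a * z‖ ^ 2 = ‖z - a‖ ^ 2 + (1 - ‖a‖ ^ 2) * (1 - ‖z‖ ^ 2) := by
  simp only [Complex.sq_norm, Complex.normSq_apply, Complex.sub_re, Complex.sub_im, Complex.mul_re,
    Complex.mul_im, Complex.conj_re, Complex.conj_im, Complex.one_re, Complex.one_im]
  ring

theorem one_sub_conj_mul_ne_zero (ha : ‖a‖ < 1) (hz : ‖z‖ ≤ 1) : 1 - conj a * z ≠ 0 := by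
  intro h
  have h1 : ‖conj a * z‖ = 1 := by rw [← sub_eq_zero.mp h, norm_one]
  rw [norm_mul, RCLike.norm_conj] at h1
  nlinarith [norm_nonneg a, norm_nonneg z]

theorem one_sub_norm_mobius_sq (ha : ‖a‖ < 1) (hz : ‖z‖ ≤ 1) :
    1 - ‖mobius a z‖ ^ 2 = (1 - ‖a‖ ^ 2) * (1 - ‖z‖ ^ 2) / ‖1 - conj a * z‖ ^ 2 := by
  have h := norm_ne_zero_iff.mpr (one_sub_conj_mul_ne_zero ha hz)
  rw [mobius, norm_div, eq_div_iff (pow_ne_zero 2 h)]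
  rw [div_pow, sub_mul, div_mul_cancel₀ _ (pow_ne_zero 2 h), norm_one_sub_conj_mul_sq]
  ring

theorem norm_mobius_le_one (ha : ‖a‖ < 1) (hz : ‖z‖ ≤ 1) : ‖mobius a z‖ ≤ 1 := by
  have h := one_sub_norm_mobius_sq ha hz
  have : 0 ≤ (1 - ‖a‖ ^ 2) * (1 - ‖z‖ ^ 2) / ‖1 - conj a * z‖ ^ 2 :=
    div_nonneg (mul_nonneg (by nlinarith [norm_nonneg a]) (by nlinarith [norm_nonneg z]))
      (sq_nonneg _)
  nlinarith [norm_nonneg (mobius a z)]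

theorem norm_mobius_lt_one (ha : ‖a‖ < 1) (hz : ‖z‖ < 1) : ‖mobius a z‖ < 1 := by
  have h := one_sub_norm_mobius_sq ha hz.le
  have h' := norm_pos_iff.mpr (one_sub_conj_mul_ne_zero ha hz.le)
  have : 0 < (1 - ‖a‖ ^ 2) * (1 - ‖z‖ ^ 2) / ‖1 - conj a * z‖ ^ 2 :=
    div_pos (mul_pos (by nlinarith [norm_nonneg a]) (by nlinarith [norm_nonneg z])) (by positivity)
  nlinarith [norm_nonneg (mobius a z)]

@[simp] theorem mobius_self (a : ℂ) : mobius a a = 0 := by simp [mobius]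

theorem mobius_neg_mobius (ha : ‖a‖ < 1) (hz : ‖z‖ ≤ 1) : mobius (-a) (mobius a z) = z := by
  have h := one_sub_conj_mul_ne_zero ha hz
  have h' := one_sub_conj_mul_ne_zero ha ha.le
  have e : z - a + a * (1 - conj a * z) = (1 - conj a * a) * z := by ring
  have e' : 1 - conj a * z + conj a * (z - a) = 1 - conj a * a := by ring
  simp only [mobius, map_neg, sub_neg_eq_add, neg_mul]
  rw [div_add' _ _ _ h, ← mul_div_assoc, add_comm 1, div_add' _ _ _ h, div_div_div_cancel_right₀ h,
    e, one_mul, add_comm (conj a * (z - a)), e', mul_div_cancel_left₀ _ h']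

theorem eq_of_mobius_eq_zero (ha : ‖a‖ < 1) (hz : ‖z‖ ≤ 1) (h : mobius a z = 0) : z = a := by
  rw [mobius, div_eq_zero_iff] at h
  exact sub_eq_zero.mp (h.resolve_right (one_sub_conj_mul_ne_zero ha hz))

theorem differentiableAt_mobius (h : 1 - conj a * z ≠ 0) : DifferentiableAt ℂ (mobius a) z := by
  unfold mobius
  fun_prop (disch := assumption)

theorem differentiableOn_mobius_disc (ha : ‖a‖ < 1) : DifferentiableOn ℂ (mobius a) disc :=
  fun _ hz => (differentiableAt_mobius (one_sub_conj_mul_ne_zero ha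
    (mem_ball_zero_iff.mp hz).le)).differentiableWithinAt

theorem mapsTo_mobius_disc (ha : ‖a‖ < 1) : MapsTo (mobius a) disc disc := fun _ hz =>
  mem_ball_zero_iff.mpr (norm_mobius_lt_one ha (mem_ball_zero_iff.mp hz))

end Mobius

/-! ### Finite Blaschke products -/

section Blaschke

variable {k : ℕ} {B : ℂ → ℂ} {w l : ℂ}

theorem IsBlaschkeProduct.congr {B' : ℂ → ℂ} (hB : IsBlaschkeProduct k B)
    (h : ∀ z ∈ disc, B' z = B z) : IsBlaschkeProduct k B' := by
  obtain ⟨c, a, hc, ha, hB⟩ := hB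
  exact ⟨c, a, hc, ha, fun z hz => (h z hz).trans (hB z hz)⟩

theorem IsBlaschkeProduct.mobius_mul (hB : IsBlaschkeProduct k B) (hl : l ∈ disc) :
    IsBlaschkeProduct (k + 1) fun z => mobius l z * B z := by
  obtain ⟨c, a, hc, ha, hB⟩ := hB
  refine ⟨c, Fin.cons l a, hc, Fin.cases hl ha, fun z hz => ?_⟩
  simp only [hB z hz, Fin.prod_univ_succ, Fin.cons_zero, Fin.cons_succ]
  ring

open Polynomial in
/-- Over an algebraically closed field, the roots of a polynomial can be listed as a family. -/
theorem exists_eq_C_mul_prod_X_sub_C (N : ℂ[X]) (hN : N.natDegree = k) :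
    ∃ b : Fin k → ℂ, N = C N.leadingCoeff * ∏ j, (X - C (b j)) := by
  have hs := IsAlgClosed.splits N
  have hcard : N.roots.toList.length = k := by
    rw [Multiset.length_toList, ← hs.natDegree_eq_card_roots, hN]
  subst hcard
  refine ⟨N.roots.toList.get, ?_⟩
  conv_lhs => rw [hs.eq_prod_roots]
  congr 1
  rw [← List.prod_ofFn, ← Multiset.coe_toList N.roots, Multiset.map_coe, Multiset.prod_coe]
  congr 1
  apply List.ext_get <;> simp

theorem prod_one_sub_conj_mul_eq_pow_mul_conj (a : Fin k → ℂ) {z : ℂ} (hz : z ≠ 0) :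
    ∏ j, (1 - conj (a j) * z) = z ^ k * conj (∏ j, ((conj z)⁻¹ - a j)) := by
  rw [map_prod]
  have : z ^ k = ∏ _j : Fin k, z := by simp
  rw [this, ← Finset.prod_mul_distrib]
  refine Finset.prod_congr rfl fun j _ => ?_
  simp only [map_sub, map_inv₀, Complex.conj_conj]
  field_simp

theorem prod_sub_eq_pow_mul_conj (a : Fin k → ℂ) {z : ℂ} (hz : z ≠ 0) :
    ∏ j, (z - a j) = z ^ k * conj (∏ j, (1 - conj (a j) * (conj z)⁻¹)) := by
  rw [map_prod]
  have : z ^ k = ∏ _j : Fin k, z := by simp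
  rw [this, ← Finset.prod_mul_distrib]
  refine Finset.prod_congr rfl fun j _ => ?_
  simp only [map_sub, map_inv₀, map_mul, map_one, Complex.conj_conj]
  field_simp

open Polynomial in
/-- Composing a finite Blaschke product with a disc automorphism keeps the degree. -/
theorem IsBlaschkeProduct.mobius_comp (hB : IsBlaschkeProduct k B) (hw : w ∈ disc) :
    IsBlaschkeProduct k fun z => mobius w (B z) := by
  obtain ⟨c, a, hc, ha, hB⟩ := hB
  rw [mem_ball_zero_iff] at hw
  simp only [mem_ball_zero_iff] at ha
  have hc0 : c ≠ 0 := by rintro rfl; simp at hc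
  set N : ℂ[X] := C c * ∏ j, (X - C (a j)) - C w * ∏ j, (1 - C (conj (a j)) * X) with hNdef
  have hNeval (z : ℂ) : N.eval z = c * ∏ j, (z - a j) - w * ∏ j, (1 - conj (a j) * z) := by
    simp [hNdef, eval_prod]
  have hdeg1 : (∏ j, (X - C (a j))).natDegree = k := by
    simp [natDegree_prod_of_monic _ _ fun j _ => monic_X_sub_C (a j)]
  have hdegfac (j : Fin k) : (1 - C (conj (a j)) * X : ℂ[X]).natDegree ≤ 1 := by
    refine (natDegree_sub_le _ _).trans ?_
    simp only [natDegree_one, zero_le, sup_of_le_right]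
    exact (natDegree_C_mul_le _ _).trans natDegree_X_le
  have hdeg2 : (∏ j, (1 - C (conj (a j)) * X : ℂ[X])).natDegree ≤ k := by
    refine (natDegree_prod_le _ _).trans ((Finset.sum_le_sum fun j _ => hdegfac j).trans ?_)
    simp
  have hcoeff1 : (∏ j, (X - C (a j))).coeff k = 1 := by
    have := (monic_prod_of_monic Finset.univ _ fun j _ => monic_X_sub_C (a j))
    rw [Monic, leadingCoeff, hdeg1] at this
    exact this
  have hcoeff2 : (∏ j, (1 - C (conj (a j)) * X : ℂ[X])).coeff k = ∏ j, (-conj (a j)) := by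
    have := coeff_prod_of_natDegree_le (s := Finset.univ)
      (f := fun j : Fin k => (1 - C (conj (a j)) * X : ℂ[X])) 1 fun j _ => hdegfac j
    simpa [coeff_one] using this
  have hcoeff : N.coeff k = c - w * ∏ j, (-conj (a j)) := by
    rw [hNdef, coeff_sub, coeff_C_mul, coeff_C_mul, hcoeff1, hcoeff2, mul_one]
  -- The degree does not drop, because `‖w‖ * ∏ ‖a j‖ < 1 = ‖c‖`.
  have hcoeff0 : N.coeff k ≠ 0 := by
    rw [hcoeff]
    intro h
    have h1 : ‖w * ∏ j, (-conj (a j))‖ = 1 := by rw [← sub_eq_zero.mp h, hc]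
    rw [norm_mul, norm_prod] at h1
    have h2 : ∏ j, ‖-conj (a j)‖ ≤ 1 := Finset.prod_le_one (fun _ _ => norm_nonneg _) fun j _ => by
      simpa using (ha j).le
    have h3 : 0 ≤ ∏ j, ‖-conj (a j)‖ := Finset.prod_nonneg fun _ _ => norm_nonneg _
    nlinarith [norm_nonneg w]
  have hNdeg : N.natDegree = k := by
    refine le_antisymm ((natDegree_sub_le _ _).trans (max_le ?_ ?_))
      (le_natDegree_of_ne_zero hcoeff0)
    · exact (natDegree_C_mul_le _ _).trans hdeg1.le
    · exact (natDegree_C_mul_le _ _).trans hdeg2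
  obtain ⟨b, hb⟩ := exists_eq_C_mul_prod_X_sub_C N hNdeg
  set L := N.leadingCoeff with hL
  have hL0 : L ≠ 0 := by rw [hL, leadingCoeff, hNdeg]; exact hcoeff0
  have hNb (z : ℂ) : c * ∏ j, (z - a j) - w * ∏ j, (1 - conj (a j) * z) = L * ∏ j, (z - b j) := by
    rw [← hNeval, hb]
    simp [eval_prod]
  -- At a root outside the open disc each `‖1 - conj (a i) * b j‖` is at most `‖b j - a i‖`, so the
  -- two terms of `N` cannot cancel when `‖w‖ < 1`.
  have hbdisc (j : Fin k) : ‖b j‖ < 1 := by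
    by_contra! hbj
    have h0 : ∏ i, (b j - b i) = 0 := Finset.prod_eq_zero (Finset.mem_univ j) (sub_self _)
    have h1 := hNb (b j)
    rw [h0, mul_zero, sub_eq_zero] at h1
    have h2 : ∏ i, ‖1 - conj (a i) * b j‖ ≤ ∏ i, ‖b j - a i‖ := by
      refine Finset.prod_le_prod (fun _ _ => norm_nonneg _) fun i _ => ?_
      have := norm_one_sub_conj_mul_sq (a i) (b j)
      have h3 : 0 ≤ (1 - ‖a i‖ ^ 2) * (‖b j‖ ^ 2 - 1) :=
        mul_nonneg (by nlinarith [ha i, norm_nonneg (a i)]) (by nlinarith)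
      exact (sq_le_sq₀ (norm_nonneg _) (norm_nonneg _)).mp (by linarith)
    have h3 : 0 < ∏ i, ‖b j - a i‖ := Finset.prod_pos fun i _ => by
      rw [norm_pos_iff, sub_ne_zero]
      rintro h
      have := ha i
      rw [← h] at this
      linarith
    have h4 := congrArg norm h1
    rw [norm_mul, norm_mul, hc, one_mul, norm_prod, norm_prod] at h4
    have h5 : 0 ≤ ∏ i, ‖1 - conj (a i) * b j‖ := Finset.prod_nonneg fun _ _ => norm_nonneg _
    nlinarith [norm_nonneg w]
  -- Reflecting `N` in the circle, `z ↦ z ^ k * conj (N (1 / conj z))`, factors the denominator with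
  -- the same `b`. The reflection needs `z ≠ 0`; continuity fills in the origin.
  have hden : (fun z : ℂ => conj c * ∏ j, (1 - conj (a j) * z) - conj w * ∏ j, (z - a j)) =
      fun z => conj L * ∏ j, (1 - conj (b j) * z) := by
    refine Continuous.ext_on (dense_compl_singleton (0 : ℂ)) (by fun_prop) (by fun_prop) ?_
    intro z hz
    replace hz : z ≠ 0 := hz
    have := congrArg conj (hNb ((conj z)⁻¹))
    simp only [map_sub, map_mul] at this
    simp only [prod_one_sub_conj_mul_eq_pow_mul_conj _ hz, prod_sub_eq_pow_mul_conj _ hz]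
    linear_combination z ^ k * this
  refine ⟨L * (c * conj L)⁻¹, b, ?_, fun j => mem_ball_zero_iff.mpr (hbdisc j), fun z hz => ?_⟩
  · rw [norm_mul, norm_inv, norm_mul, hc, RCLike.norm_conj, one_mul,
      mul_inv_cancel₀ (norm_ne_zero_iff.mpr hL0)]
  have hz1 : ‖z‖ ≤ 1 := (mem_ball_zero_iff.mp hz).le
  have hq : ∏ j, (1 - conj (a j) * z) ≠ 0 :=
    Finset.prod_ne_zero_iff.mpr fun j _ => one_sub_conj_mul_ne_zero (ha j) hz1
  have hq' : ∏ j, (1 - conj (b j) * z) ≠ 0 :=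
    Finset.prod_ne_zero_iff.mpr fun j _ => one_sub_conj_mul_ne_zero (hbdisc j) hz1
  have hLc : conj L ≠ 0 := by simpa using hL0
  have hcc : c * conj c = 1 := by
    rw [Complex.mul_conj, Complex.normSq_eq_norm_sq, hc]; simp
  have hd : ∏ j, (1 - conj (a j) * z) - conj w * (c * ∏ j, (z - a j)) =
      c * conj L * ∏ j, (1 - conj (b j) * z) := by
    have := congrFun hden z
    linear_combination c * this - (∏ j, (1 - conj (a j) * z)) * hcc
  simp only [hB z hz, mobius, Finset.prod_div_distrib]
  rw [← mul_div_assoc, div_sub' hq, ← mul_div_assoc, one_sub_div hq,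
    div_div_div_cancel_right₀ hq, hd, mul_comm _ w, hNb]
  field_simp

theorem IsBlaschkeProduct.mapsTo_disc (hB : IsBlaschkeProduct k B) (hk : 0 < k) :
    MapsTo B disc disc := by
  obtain ⟨c, a, hc, ha, hB⟩ := hB
  intro z hz
  simp only [mem_ball_zero_iff] at ha hz ⊢
  obtain ⟨k, rfl⟩ := Nat.exists_eq_succ_of_ne_zero hk.ne'
  rw [hB z (mem_ball_zero_iff.mpr hz), norm_mul, hc, one_mul, norm_prod, Fin.prod_univ_succ]
  refine mul_lt_one_of_nonneg_of_lt_one_left (norm_nonneg _) (norm_mobius_lt_one (ha 0) hz) ?_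
  exact Finset.prod_le_one (fun _ _ => norm_nonneg _) fun j _ =>
    norm_mobius_le_one (ha _) hz.le

/-- `mobius w ∘ B` is again a Blaschke product of positive degree, hence has a zero in the disc. -/
theorem IsBlaschkeProduct.exists_eq (hB : IsBlaschkeProduct k B) (hk : 0 < k) (hw : w ∈ disc) :
    ∃ z ∈ disc, B z = w := by
  obtain ⟨c, a, hc, ha, h⟩ := hB.mobius_comp hw
  set j : Fin k := ⟨0, hk⟩
  have h1 : mobius w (B (a j)) = 0 := by
    rw [show mobius w (B (a j)) = _ from h _ (ha j),
      Finset.prod_eq_zero (Finset.mem_univ j) (mobius_self _), mul_zero]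
  exact ⟨a j, ha j, eq_of_mobius_eq_zero (mem_ball_zero_iff.mp hw)
    (mem_ball_zero_iff.mp (hB.mapsTo_disc hk (ha j))).le h1⟩

theorem IsBlaschkeProduct.pos_of_not_isConstOnDisc (hB : IsBlaschkeProduct k B)
    (h : ¬ IsConstOnDisc B) : 0 < k := by
  rcases Nat.eq_zero_or_pos k with rfl | hk
  · obtain ⟨c, a, -, -, hB⟩ := hB
    exact absurd ⟨c, fun z hz => by simpa using hB z hz⟩ h
  · exact hk

theorem IsBlaschkeProduct.differentiableOn (hB : IsBlaschkeProduct k B) :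
    DifferentiableOn ℂ B disc := by
  obtain ⟨c, a, hc, ha, hB⟩ := hB
  refine DifferentiableOn.congr (f := fun z => c * ∏ j, mobius (a j) z) ?_ hB
  exact (DifferentiableOn.fun_finsetProd fun j _ =>
    differentiableOn_mobius_disc (mem_ball_zero_iff.mp (ha j))).const_mul c

end Blaschke

/-! ### The Schwarz–Pick inequality and the Schur step -/

section SchwarzPick

variable {g : ℂ → ℂ} {l : ℂ}

theorem norm_mobius_comp_le (hg : HolDisc disc g) {l z : ℂ} (hl : l ∈ disc) (hz : z ∈ disc) :
    ‖mobius (g l) (g z)‖ ≤ ‖mobius l z‖ := by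
  have hgl := mem_ball_zero_iff.mp (hg.2 hl)
  have hl' : ‖l‖ < 1 := mem_ball_zero_iff.mp hl
  have hnl : ‖-l‖ < 1 := by rwa [norm_neg]
  have hz' : ‖z‖ < 1 := mem_ball_zero_iff.mp hz
  have hd : DifferentiableOn ℂ (fun ζ => mobius (g l) (g (mobius (-l) ζ))) disc :=
    (differentiableOn_mobius_disc hgl).comp
      (hg.1.comp (differentiableOn_mobius_disc hnl) (mapsTo_mobius_disc hnl))
      (hg.2.comp (mapsTo_mobius_disc hnl))
  have hm : MapsTo (fun ζ => mobius (g l) (g (mobius (-l) ζ))) disc (Metric.closedBall 0 1) :=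
    fun ζ hζ => Metric.ball_subset_closedBall
      (mapsTo_mobius_disc hgl (hg.2 (mapsTo_mobius_disc hnl hζ)))
  have h0 : mobius (g l) (g (mobius (-l) 0)) = 0 := by simp [mobius]
  have := Complex.norm_le_norm_of_mapsTo_ball hd hm h0 (norm_mobius_lt_one hl' hz')
  simpa only [mobius_neg_mobius hl' hz'.le] using this

/-- A Schur function is a unimodular constant or takes its values in the open disc. -/
theorem isBlaschkeProduct_zero_or_holDisc (hg : DifferentiableOn ℂ g disc)
    (hg1 : ∀ z ∈ disc, ‖g z‖ ≤ 1) : IsBlaschkeProduct 0 g ∨ HolDisc disc g := by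
  by_cases h : ∃ z ∈ disc, ‖g z‖ = 1
  · obtain ⟨v, hv, hv1⟩ := h
    refine Or.inl ⟨g v, Fin.elim0, hv1, fun j => j.elim0, fun z hz => ?_⟩
    have := Complex.eq_const_of_exists_max hg hv fun z hz => by simpa [hv1] using hg1 z hz
    simpa using this hz
  · push Not at h
    exact Or.inr ⟨hg, fun z hz => mem_ball_zero_iff.mpr (lt_of_le_of_ne (hg1 z hz) (h z hz))⟩

/-- One step of the Schur algorithm. -/
theorem exists_mobius_comp_eq_mobius_mul (hg : HolDisc disc g) (hl : l ∈ disc) :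
    ∃ g₁ : ℂ → ℂ, DifferentiableOn ℂ g₁ disc ∧ (∀ z ∈ disc, ‖g₁ z‖ ≤ 1) ∧
      ∀ z ∈ disc, mobius (g l) (g z) = mobius l z * g₁ z := by
  have hgl := mem_ball_zero_iff.mp (hg.2 hl)
  have hl' : ‖l‖ < 1 := mem_ball_zero_iff.mp hl
  set G : ℂ → ℂ := fun z => mobius (g l) (g z) with hG
  have hGd : DifferentiableOn ℂ G disc := (differentiableOn_mobius_disc hgl).comp hg.1 hg.2
  have hds : DifferentiableOn ℂ (dslope G l) disc :=
    (Complex.differentiableOn_dslope (Metric.isOpen_ball.mem_nhds hl)).mpr hGd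
  have hd : DifferentiableOn ℂ (fun z => dslope G l z * (1 - conj l * z)) disc :=
    hds.mul (by fun_prop)
  have heq : ∀ z ∈ disc, G z = mobius l z * (dslope G l z * (1 - conj l * z)) := fun z hz => by
    have h1 := sub_smul_dslope G l z
    have h2 := one_sub_conj_mul_ne_zero hl' (mem_ball_zero_iff.mp hz).le
    have h3 : G l = 0 := mobius_self _
    rw [h3, sub_zero, smul_eq_mul] at h1
    rw [← h1, mobius, mul_comm (dslope G l z), ← mul_assoc, div_mul_cancel₀ _ h2]
  refine ⟨_, hd, ?_, heq⟩
  have hne : ∀ z ∈ disc \ {l}, ‖dslope G l z * (1 - conj l * z)‖ ≤ 1 := fun z hz => by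
    have h1 := norm_mobius_comp_le hg hl hz.1
    rw [show mobius (g l) (g z) = _ from heq z hz.1, norm_mul] at h1
    have h2 : 0 < ‖mobius l z‖ := norm_pos_iff.mpr fun h =>
      hz.2 (eq_of_mobius_eq_zero hl' (mem_ball_zero_iff.mp hz.1).le h)
    nlinarith
  -- At `l` itself the quotient is not controlled by Schwarz–Pick; the bound passes to the limit.
  intro z hz
  by_cases hzl : z = l
  · subst hzl
    have hc : ContinuousAt (fun y => ‖dslope G z y * (1 - conj z * y)‖) z :=
      (hd.continuousOn.continuousAt (Metric.isOpen_ball.mem_nhds hz)).norm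
    refine le_of_tendsto (hc.tendsto.mono_left (nhdsWithin_le_nhds (s := {z}ᶜ))) ?_
    filter_upwards [self_mem_nhdsWithin, mem_nhdsWithin_of_mem_nhds (Metric.isOpen_ball.mem_nhds hz)]
      with y hy hy'
    exact hne y ⟨hy', hy⟩
  · exact hne z ⟨hz, hzl⟩

end SchwarzPick

/-! ### Interpolation by the Schur algorithm -/

theorem HolClosedDisc.comp_mobius_mul {h₁ : ℂ → ℂ} (hh : HolClosedDisc disc h₁) {l w : ℂ}
    (hl : l ∈ disc) (hw : w ∈ disc) :
    HolClosedDisc disc fun z => mobius w (mobius l z * h₁ z) := by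
  obtain ⟨U, hUo, hU, hd, hm⟩ := hh
  rw [mem_ball_zero_iff] at hl hw
  set V : Set ℂ := U ∩ {z | 1 - conj l * z ≠ 0} with hV
  have hVo : IsOpen V := hUo.inter (isOpen_ne_fun (by fun_prop) (by fun_prop))
  have hd' : DifferentiableOn ℂ (fun z => mobius l z * h₁ z) V := fun z hz =>
    ((differentiableAt_mobius hz.2).differentiableWithinAt).mul
      ((hd z hz.1).mono inter_subset_left)
  refine ⟨V ∩ (fun z => mobius l z * h₁ z) ⁻¹' disc,
    hd'.continuousOn.isOpen_inter_preimage hVo Metric.isOpen_ball, ?_, ?_, ?_⟩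
  · intro z hz
    have hz1 : ‖z‖ ≤ 1 := mem_closedBall_zero_iff.mp hz
    refine ⟨⟨hU hz, one_sub_conj_mul_ne_zero hl hz1⟩, ?_⟩
    have h1 := mem_ball_zero_iff.mp (hm (hU hz))
    rw [mem_preimage, mem_ball_zero_iff, norm_mul]
    exact mul_lt_one_of_nonneg_of_lt_one_right (norm_mobius_le_one hl hz1) (norm_nonneg _) h1
  · exact (differentiableOn_mobius_disc hw).comp (hd'.mono inter_subset_left) fun z hz => hz.2
  · exact fun z hz => mapsTo_mobius_disc hw hz.2

/-- A Schur function which is not a Blaschke product of degree less than `m` can be interpolated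
at `m` points by a strict Schur function that is holomorphic across the unit circle. -/
theorem isBlaschkeProduct_or_exists_interpolation (m : ℕ) :
    ∀ (g : ℂ → ℂ), DifferentiableOn ℂ g disc → (∀ z ∈ disc, ‖g z‖ ≤ 1) →
      ∀ l : Fin m → ℂ, Function.Injective l → (∀ j, l j ∈ disc) →
        (∃ k < m, IsBlaschkeProduct k g) ∨
          ∃ h, HolClosedDisc disc h ∧ ∀ j, h (l j) = g (l j) := by
  induction m with
  | zero =>
    intro g _ _ l _ _
    exact Or.inr ⟨fun _ => 0, ⟨univ, isOpen_univ, subset_univ _, by fun_prop, fun _ _ => by simp⟩,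
      fun j => j.elim0⟩
  | succ m ih =>
    intro g hg hg1 l hl hld
    rcases isBlaschkeProduct_zero_or_holDisc hg hg1 with h | h
    · exact Or.inl ⟨0, m.succ_pos, h⟩
    have hw : g (l 0) ∈ disc := h.2 (hld 0)
    have hw' : ‖g (l 0)‖ < 1 := mem_ball_zero_iff.mp hw
    have hnw : -g (l 0) ∈ disc := by simpa using hw'
    obtain ⟨g₁, hg₁, hg₁1, heq⟩ := exists_mobius_comp_eq_mobius_mul h (hld 0)
    -- Inverting the Schur step: `g₁` has one point fewer to interpolate, and the step back raises a
    -- Blaschke degree by one.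
    have hrec : ∀ z ∈ disc, g z = mobius (-g (l 0)) (mobius (l 0) z * g₁ z) := fun z hz => by
      rw [← heq z hz, mobius_neg_mobius hw' (hg1 z hz)]
    rcases ih g₁ hg₁ hg₁1 (fun j => l j.succ) (fun i j hij => Fin.succ_injective _ (hl hij))
      (fun j => hld _) with ⟨k, hk, hB⟩ | ⟨h₁, hh₁, hh₁l⟩
    · exact Or.inl ⟨k + 1, Nat.succ_lt_succ hk,
        ((hB.mobius_mul (hld 0)).mobius_comp hnw).congr hrec⟩
    · refine Or.inr ⟨_, hh₁.comp_mobius_mul (hld 0) hnw, Fin.cases ?_ fun j => ?_⟩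
      · simp [mobius]
      · simp only [hh₁l j, ← hrec _ (hld j.succ)]

/-! ### Uniqueness of interpolation by a Blaschke product -/

theorem exists_eq_prod_sub_mul {U : Set ℂ} (hU : IsOpen U) (n : ℕ) :
    ∀ (G : ℂ → ℂ), DifferentiableOn ℂ G U → ∀ l : Fin n → ℂ, Function.Injective l →
      (∀ j, l j ∈ U) → (∀ j, G (l j) = 0) →
      ∃ H : ℂ → ℂ, DifferentiableOn ℂ H U ∧ ∀ z, G z = (∏ j, (z - l j)) * H z := by
  induction n with
  | zero => exact fun G hG _ _ _ _ => ⟨G, hG, by simp⟩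
  | succ n ih =>
    intro G hG l hl hlU hl0
    have hd : DifferentiableOn ℂ (dslope G (l 0)) U :=
      (Complex.differentiableOn_dslope (hU.mem_nhds (hlU 0))).mpr hG
    have heq (z : ℂ) : G z = (z - l 0) * dslope G (l 0) z := by
      have := sub_smul_dslope G (l 0) z
      rw [hl0, sub_zero, smul_eq_mul] at this
      exact this.symm
    obtain ⟨H, hH, hHe⟩ := ih _ hd (fun j => l j.succ)
      (fun i j hij => Fin.succ_injective _ (hl hij)) (fun j => hlU _) fun j => by
        have h1 := heq (l j.succ)
        rw [hl0, eq_comm, mul_eq_zero, sub_eq_zero] at h1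
        exact h1.resolve_left fun h => Fin.succ_ne_zero j (hl h)
    refine ⟨H, hH, fun z => ?_⟩
    rw [heq z, hHe z, Fin.prod_univ_succ, mul_assoc]

/-- The minimum principle for the real part: the maximum modulus principle applied to `exp (-F)`. -/
theorem exists_norm_eq_one_and_re_nonpos {U : Set ℂ}
    (hUc : Metric.closedBall (0 : ℂ) 1 ⊆ U) {F : ℂ → ℂ} (hF : DifferentiableOn ℂ F U) {l : ℂ}
    (hl : l ∈ disc) (hl0 : F l = 0) : ∃ z, ‖z‖ = 1 ∧ (F z).re ≤ 0 := by
  have hd : DiffContOnCl ℂ (fun z => Complex.exp (-F z)) disc := by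
    refine DifferentiableOn.diffContOnCl ?_
    rw [closure_ball _ one_ne_zero]
    exact (hF.mono hUc).neg.cexp
  obtain ⟨z, hz, hmax⟩ := Complex.exists_mem_frontier_isMaxOn_norm Metric.isBounded_ball
    ⟨l, hl⟩ hd
  refine ⟨z, ?_, ?_⟩
  · rwa [frontier_ball _ one_ne_zero, mem_sphere_zero_iff_norm] at hz
  · have := hmax (subset_closure hl)
    simpa [hl0, Complex.norm_exp] using this

theorem one_sub_conj_mul_mul_sub {z : ℂ} (hz : ‖z‖ = 1) (a : ℂ) :
    (1 - conj a * z) * (z - a) = z * (‖z - a‖ ^ 2 : ℝ) := by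
  have h : z * conj z = 1 := by rw [Complex.mul_conj, Complex.normSq_eq_norm_sq, hz]; simp
  rw [Complex.sq_norm, ← Complex.mul_conj, map_sub]
  linear_combination (-(z - a)) * h

/-- A Blaschke product of degree `k` is determined by its values at `k + 1` points among the strict
Schur functions that are holomorphic across the circle. -/
theorem HolClosedDisc.not_eq_blaschkeProduct {k : ℕ} {B g : ℂ → ℂ} (hB : IsBlaschkeProduct k B)
    (hg : HolClosedDisc disc g) {l : Fin (k + 1) → ℂ} (hl : Function.Injective l)
    (hld : ∀ j, l j ∈ disc) : ∃ j, g (l j) ≠ B (l j) := by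
  by_contra! hgB
  obtain ⟨c, a, hc, ha, hB⟩ := hB
  obtain ⟨U, hUo, hU, hd, hm⟩ := hg
  simp only [mem_ball_zero_iff] at ha
  have hld' (j) : ‖l j‖ < 1 := mem_ball_zero_iff.mp (hld j)
  set p : ℂ → ℂ := fun z => ∏ j, (z - a j) with hp
  set q : ℂ → ℂ := fun z => ∏ j, (1 - conj (a j) * z) with hq
  -- The point `l 0` is left out, so that `r` and `s` have `k` factors like `p` and `q`; the
  -- remaining factor `z - l 0` gives the zero of the test function below.
  set r : ℂ → ℂ := fun z => ∏ j : Fin k, (z - l j.succ) with hr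
  set s : ℂ → ℂ := fun z => ∏ j : Fin k, (1 - conj (l j.succ) * z) with hs
  have hq0 {z : ℂ} (hz : ‖z‖ ≤ 1) : q z ≠ 0 :=
    Finset.prod_ne_zero_iff.mpr fun j _ => one_sub_conj_mul_ne_zero (ha j) hz
  have hs0 {z : ℂ} (hz : ‖z‖ ≤ 1) : s z ≠ 0 :=
    Finset.prod_ne_zero_iff.mpr fun j _ => one_sub_conj_mul_ne_zero (hld' j.succ) hz
  have hpd : Differentiable ℂ p := by fun_prop
  have hqd : Differentiable ℂ q := by fun_prop
  have hsd : Differentiable ℂ s := by fun_prop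
  set V : Set ℂ := U ∩ {z | q z ≠ 0} ∩ {z | s z ≠ 0} with hV
  have hVo : IsOpen V := (hUo.inter (isOpen_ne_fun hqd.continuous continuous_const)).inter
    (isOpen_ne_fun hsd.continuous continuous_const)
  have hUV : Metric.closedBall (0 : ℂ) 1 ⊆ V := fun z hz =>
    ⟨⟨hU hz, hq0 (mem_closedBall_zero_iff.mp hz)⟩, hs0 (mem_closedBall_zero_iff.mp hz)⟩
  have hG : DifferentiableOn ℂ (fun z => c * p z / q z - g z) V :=
    ((hpd.differentiableOn.const_mul c).div hqd.differentiableOn fun z hz => hz.1.2).sub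
      (hd.mono fun z hz => hz.1.1)
  obtain ⟨H, hH, hGH⟩ := exists_eq_prod_sub_mul hVo (k + 1) _ hG l hl
    (fun j => hUV (Metric.ball_subset_closedBall (hld j))) fun j => by
      rw [hgB j, hB _ (hld j), hp, hq]
      simp only [mobius, Finset.prod_div_distrib]
      ring
  -- On the circle this function is a positive factor times `1 - conj (B z) * g z`, with `B`
  -- continued as `c * p / q`. Its real part is positive there since `‖g z‖ < 1`, yet it vanishes at
  -- `l 0`.
  have hF : DifferentiableOn ℂ (fun z => conj c * q z ^ 2 / s z * (z - l 0) * H z) V :=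
    ((((hqd.pow 2).const_mul (conj c)).differentiableOn.div hsd.differentiableOn
      fun z hz => hz.2).mul (by fun_prop)).mul hH
  obtain ⟨z, hz, hre⟩ := exists_norm_eq_one_and_re_nonpos hUV hF (hld 0) (by simp)
  refine hre.not_gt ?_
  have hsub {b : ℂ} (hb : ‖b‖ < 1) : z - b ≠ 0 := by
    rw [sub_ne_zero]; rintro rfl; exact hb.ne hz
  have hp0 : p z ≠ 0 := Finset.prod_ne_zero_iff.mpr fun j _ => hsub (ha j)
  have hr0 : r z ≠ 0 := Finset.prod_ne_zero_iff.mpr fun j _ => hsub (hld' j.succ)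
  have hq0' := hq0 hz.le
  have hs0' := hs0 hz.le
  have hz0 : z ≠ 0 := by rintro rfl; simp at hz
  have hzk : z ^ k = ∏ _j : Fin k, z := by simp
  have hqp : q z * p z = z ^ k * (∏ j, ‖z - a j‖ ^ 2 : ℝ) := by
    rw [hq, hp, ← Finset.prod_mul_distrib, hzk, Complex.ofReal_prod, ← Finset.prod_mul_distrib]
    exact Finset.prod_congr rfl fun j _ => one_sub_conj_mul_mul_sub hz _
  have hsr : s z * r z = z ^ k * (∏ j : Fin k, ‖z - l j.succ‖ ^ 2 : ℝ) := by
    rw [hs, hr, ← Finset.prod_mul_distrib, hzk, Complex.ofReal_prod, ← Finset.prod_mul_distrib]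
    exact Finset.prod_congr rfl fun j _ => one_sub_conj_mul_mul_sub hz _
  set σ : ℝ := ∏ j, ‖z - a j‖ ^ 2 with hσ
  set ρ : ℝ := ∏ j : Fin k, ‖z - l j.succ‖ ^ 2 with hρ
  have hσ0 : 0 < σ := Finset.prod_pos fun j _ => by
    have := norm_pos_iff.mpr (hsub (ha j)); positivity
  have hρ0 : 0 < ρ := Finset.prod_pos fun j _ => by
    have := norm_pos_iff.mpr (hsub (hld' j.succ)); positivity
  have hratio : q z * p z / (s z * r z) = ((σ / ρ : ℝ) : ℂ) := by
    rw [hqp, hsr, mul_div_mul_left _ _ (pow_ne_zero k hz0), Complex.ofReal_div]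
  have hcc : conj c * c = 1 := by
    rw [mul_comm, Complex.mul_conj, Complex.normSq_eq_norm_sq, hc]; simp
  have hnorm : ‖q z‖ = ‖p z‖ := by
    simp only [hq, hp, norm_prod]
    refine Finset.prod_congr rfl fun j _ => ?_
    have := norm_one_sub_conj_mul_sq (a j) z
    rw [hz] at this
    exact (sq_eq_sq₀ (norm_nonneg _) (norm_nonneg _)).mp (by linarith)
  have hu : ‖conj c * (q z / p z) * g z‖ < 1 := by
    rw [norm_mul, norm_mul, norm_div, hnorm, div_self (norm_ne_zero_iff.mpr hp0), RCLike.norm_conj,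
      hc, one_mul, one_mul]
    exact mem_ball_zero_iff.mp (hm (hU (mem_closedBall_zero_iff.mpr hz.le)))
  have hkey : conj c * q z ^ 2 / s z * (z - l 0) * H z =
      ((σ / ρ : ℝ) : ℂ) * (1 - conj c * (q z / p z) * g z) := by
    have h1 := hGH z
    rw [Fin.prod_univ_succ, show ∏ j : Fin k, (z - l j.succ) = r z from rfl] at h1
    rw [← hratio]
    have h2 : (z - l 0) * H z = (c * p z / q z - g z) / r z := by
      rw [h1]; field_simp
    rw [mul_assoc, h2]
    field_simp
    linear_combination p z * hcc
  rw [hkey, Complex.re_ofReal_mul]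
  refine mul_pos (div_pos hσ0 hρ0) ?_
  rw [Complex.sub_re, Complex.one_re, sub_pos]
  exact (Complex.re_le_norm _).trans_lt hu

/-! ### Lifting through the covering -/

theorem simplyConnectedSpace_ball {R : ℝ} (hR : 0 < R) :
    SimplyConnectedSpace (Metric.ball (0 : ℂ) R) :=
  have := (convex_ball (0 : ℂ) R).contractibleSpace (Metric.nonempty_ball.mpr hR)
  SimplyConnectedSpace.ofContractible _

section Lift

variable {D : Set ℂ} {P : ℂ → ℂ}

theorem IsHolCovering.exists_nhds_injOn (hP : IsHolCovering D P) {e : ℂ} (he : e ∈ disc) :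
    ∃ V ∈ 𝓝 e, V ⊆ disc ∧ InjOn P V := by
  obtain ⟨-, hm, hcov, -⟩ := hP
  obtain ⟨V, hV, hinj⟩ := isLocallyInjective_iff_nhds.mp
    hcov.isLocalHomeomorph.isLocallyInjective ⟨e, he⟩
  refine ⟨Subtype.val '' V, ?_, ?_, ?_⟩
  · exact (Metric.isOpen_ball.isOpenEmbedding_subtypeVal.image_mem_nhds (x := ⟨e, he⟩)).mpr hV
  · rintro _ ⟨x, -, rfl⟩
    exact x.2
  · rintro _ ⟨x, hx, rfl⟩ _ ⟨y, hy, rfl⟩ hxy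
    exact congrArg _ (hinj hx hy (Subtype.ext hxy))

/-- A continuous lift of a holomorphic function through a locally injective holomorphic function
is holomorphic. -/
theorem differentiableAt_of_comp_eq {V : Set ℂ} {g φ : ℂ → ℂ} {z₀ : ℂ} (hV : V ∈ 𝓝 (g z₀))
    (hPd : DifferentiableOn ℂ P V) (hinj : InjOn P V) (hg : ∀ᶠ z in 𝓝 z₀, ContinuousAt g z)
    (hφ : AnalyticAt ℂ φ z₀) (heq : ∀ᶠ z in 𝓝 z₀, P (g z) = φ z) : DifferentiableAt ℂ g z₀ := by
  have hPan : AnalyticAt ℂ P (g z₀) := hPd.analyticAt hV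
  have hgz : Tendsto g (𝓝 z₀) (𝓝 (g z₀)) := hg.self_of_nhds
  have hgV : ∀ᶠ z in 𝓝 z₀, g z ∈ V := hgz hV
  -- `g` is differentiable wherever its value is not critical for `P`
  have key : ∀ z₁, ContinuousAt g z₁ → AnalyticAt ℂ φ z₁ → AnalyticAt ℂ P (g z₁) →
      (∀ᶠ z in 𝓝 z₁, P (g z) = φ z) → deriv P (g z₁) ≠ 0 → DifferentiableAt ℂ g z₁ := by
    intro z₁ hc hφ₁ hP₁ heq₁ hne
    have hcont : ContinuousAt (dslope P (g z₁)) (g z₁) :=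
      continuousAt_dslope_same.mpr hP₁.differentiableAt
    have h1 : Tendsto (fun z => dslope P (g z₁) (g z)) (𝓝 z₁) (𝓝 (deriv P (g z₁))) := by
      have := hcont.tendsto.comp hc.tendsto
      rwa [dslope_same] at this
    have h2 : Tendsto (slope φ z₁) (𝓝[≠] z₁) (𝓝 (deriv φ z₁)) :=
      hasDerivAt_iff_tendsto_slope.mp hφ₁.differentiableAt.hasDerivAt
    have h3 : Tendsto (slope g z₁) (𝓝[≠] z₁) (𝓝 (deriv φ z₁ / deriv P (g z₁))) := by
      refine (h2.div (h1.mono_left nhdsWithin_le_nhds) hne).congr' ?_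
      filter_upwards [mem_nhdsWithin_of_mem_nhds heq₁,
        mem_nhdsWithin_of_mem_nhds (h1.eventually_ne hne)] with z hz hz'
      have h4 := sub_smul_dslope P (g z₁) (g z)
      rw [Pi.div_apply, div_eq_iff hz', slope_def_field, slope_def_field, ← hz,
        ← heq₁.self_of_nhds, ← h4, smul_eq_mul]
      ring
    exact (hasDerivAt_iff_tendsto_slope.mpr h3).differentiableAt
  -- If `φ` is locally constant, injectivity makes `g` so. Otherwise the critical points of `P` near
  -- `g z₀` are isolated, `g` is differentiable on a punctured neighbourhood, and the singularity at
  -- `z₀` is removable.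
  rcases hφ.eventually_eq_or_eventually_ne (g := fun _ => φ z₀) analyticAt_const with h | h
  · refine (differentiableAt_const (g z₀)).congr_of_eventuallyEq ?_
    filter_upwards [h, heq, hgV] with z h1 h2 h3
    exact hinj h3 (mem_of_mem_nhds hV) (by rw [h2, h1, heq.self_of_nhds])
  · have hPne : ∀ᶠ w in 𝓝[≠] (g z₀), deriv P w ≠ 0 := by
      rcases hPan.deriv.eventually_eq_zero_or_eventually_ne_zero with h' | h'
      · exfalso
        obtain ⟨ε, hε, hball⟩ := Metric.mem_nhds_iff.mp (inter_mem h' hV)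
        have hconst : ∀ w ∈ Metric.ball (g z₀) ε, P w = P (g z₀) := fun w hw =>
          (convex_ball (g z₀) ε).is_const_of_fderivWithin_eq_zero (𝕜 := ℂ)
            (hPd.mono fun y hy => (hball hy).2) (fun y hy => by
              rw [fderivWithin_of_isOpen Metric.isOpen_ball hy]
              ext
              simpa using (hball hy).1) hw (Metric.mem_ball_self hε)
        have hev : ∀ᶠ z in 𝓝[≠] z₀, φ z = φ z₀ := by
          filter_upwards [mem_nhdsWithin_of_mem_nhds (hgz (Metric.ball_mem_nhds _ hε)),
            mem_nhdsWithin_of_mem_nhds heq] with z h1 h2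
          rw [← h2, hconst _ h1, heq.self_of_nhds]
        obtain ⟨z, h1, h2⟩ := (hev.and h).exists
        exact h2 h1
      · exact h'
    have hgne : ∀ᶠ z in 𝓝[≠] z₀, g z ≠ g z₀ := by
      filter_upwards [h, mem_nhdsWithin_of_mem_nhds heq] with z h1 h2 h3
      exact h1 (by rw [← h2, h3, heq.self_of_nhds])
    have hgt : Tendsto g (𝓝[≠] z₀) (𝓝[≠] (g z₀)) :=
      tendsto_nhdsWithin_iff.mpr ⟨hgz.mono_left nhdsWithin_le_nhds, hgne⟩
    refine (Complex.analyticAt_of_differentiable_on_punctured_nhds_of_continuousAt ?_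
      hgz).differentiableAt
    filter_upwards [hgt hPne, mem_nhdsWithin_of_mem_nhds hg,
      mem_nhdsWithin_of_mem_nhds hφ.eventually_analyticAt,
      mem_nhdsWithin_of_mem_nhds (hgz hPan.eventually_analyticAt),
      mem_nhdsWithin_of_mem_nhds heq.eventually_nhds] with z h1 h2 h3 h4 h5
    exact key z h2 h3 h4 h5 h1

theorem IsHolCovering.exists_lift (hP : IsHolCovering D P) {R : ℝ} {φ : ℂ → ℂ}
    (hφ : DifferentiableOn ℂ φ (Metric.ball 0 R)) (hφD : MapsTo φ (Metric.ball 0 R) D) {z₀ e₀ : ℂ}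
    (hz₀ : z₀ ∈ Metric.ball 0 R) (he₀ : e₀ ∈ disc) (h₀ : P e₀ = φ z₀) :
    ∃ g : ℂ → ℂ, DifferentiableOn ℂ g (Metric.ball 0 R) ∧ MapsTo g (Metric.ball 0 R) disc ∧
      g z₀ = e₀ ∧ ∀ z ∈ Metric.ball 0 R, P (g z) = φ z := by
  have hR : 0 < R := Metric.nonempty_ball.mp ⟨z₀, hz₀⟩
  obtain ⟨hPd, hPm, hcov, -⟩ := id hP
  have := simplyConnectedSpace_ball hR
  have : LocallyPathConnectedSpace (Metric.ball (0 : ℂ) R) :=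
    Metric.isOpen_ball.locallyPathConnectedSpace
  obtain ⟨F, ⟨hF0, hF⟩, -⟩ := hcov.existsUnique_continuousMap_lifts
    ⟨hφD.restrict φ _ D, hφ.continuousOn.mapsToRestrict hφD⟩ ⟨z₀, hz₀⟩ ⟨e₀, he₀⟩ (Subtype.ext h₀)
  classical
  set g : ℂ → ℂ := fun z => if hz : z ∈ Metric.ball (0 : ℂ) R then (F ⟨z, hz⟩ : ℂ) else 0 with hg
  have hgF (z : Metric.ball (0 : ℂ) R) : g z = F z := by simp only [hg, dif_pos z.2, Subtype.coe_eta]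
  have hgc : ContinuousOn g (Metric.ball 0 R) := by
    rw [continuousOn_iff_continuous_domRestrict]
    exact (continuous_subtype_val.comp F.continuous).congr fun z => (hgF z).symm
  have hgm : MapsTo g (Metric.ball 0 R) disc := fun z hz => by
    rw [hgF ⟨z, hz⟩]
    exact (F ⟨z, hz⟩).2
  have hgP : ∀ z ∈ Metric.ball 0 R, P (g z) = φ z := fun z hz => by
    rw [hgF ⟨z, hz⟩]
    exact congrArg Subtype.val (congrFun hF ⟨z, hz⟩)
  refine ⟨g, fun z hz => ?_, hgm, ?_, hgP⟩
  · obtain ⟨V, hV, hVd, hinj⟩ := hP.exists_nhds_injOn (hgm hz)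
    have hnhds := Metric.isOpen_ball.mem_nhds hz
    refine (differentiableAt_of_comp_eq hV (hPd.mono hVd) hinj ?_ (hφ.analyticAt hnhds)
      (eventually_of_mem hnhds hgP)).differentiableWithinAt
    exact eventually_of_mem hnhds fun y hy => hgc.continuousAt (Metric.isOpen_ball.mem_nhds hy)
  · rw [hgF ⟨z₀, hz₀⟩, hF0]

theorem IsHolCovering.eqOn_of_comp_eqOn (hP : IsHolCovering D P) {s : Set ℂ}
    (hs : IsPreconnected s) {g₁ g₂ : ℂ → ℂ} (h₁ : ContinuousOn g₁ s) (h₂ : ContinuousOn g₂ s)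
    (hm₁ : MapsTo g₁ s disc) (hm₂ : MapsTo g₂ s disc) (he : ∀ z ∈ s, P (g₁ z) = P (g₂ z)) {z₀ : ℂ}
    (hz₀ : z₀ ∈ s) (h₀ : g₁ z₀ = g₂ z₀) : EqOn g₁ g₂ s := by
  obtain ⟨-, hPm, hcov, -⟩ := hP
  have := isPreconnected_iff_preconnectedSpace.mp hs
  have := hcov.eq_of_comp_eq (h₁.mapsToRestrict hm₁) (h₂.mapsToRestrict hm₂)
    (funext fun z => Subtype.ext (he z z.2)) ⟨z₀, hz₀⟩ (Subtype.ext h₀)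
  exact fun z hz => congrArg Subtype.val (congrFun this ⟨z, hz⟩)

/-- An injective covering would be a homeomorphism from the disc onto `D`. -/
theorem IsHolCovering.exists_ne_of_not_isSimplyConnected (hP : IsHolCovering D P)
    (hD : ¬ IsSimplyConnected D) : ∃ a ∈ disc, ∃ b ∈ disc, a ≠ b ∧ P a = P b := by
  by_contra! h
  obtain ⟨-, hm, hcov, hsurj⟩ := hP
  refine hD ?_
  have hinj : Function.Injective (hm.restrict P disc D) := fun x y hxy => by
    by_contra hne
    exact h x x.2 y y.2 (fun h => hne (Subtype.ext h)) (congrArg Subtype.val hxy)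
  have := simplyConnectedSpace_ball one_pos
  exact (hcov.isLocalHomeomorph.toHomeomorphOfBijective
    ⟨hinj, hsurj⟩).symm.toHomotopyEquiv.simplyConnectedSpace

end Lift

/-! ### Hyperbolic barycentres and infinite fibres -/

theorem norm_add_div_two_sq (u v : ℂ) :
    ‖(u + v) / 2‖ ^ 2 = (‖u‖ ^ 2 + ‖v‖ ^ 2) / 2 - ‖u - v‖ ^ 2 / 4 := by
  have h : ‖(u + v) / 2‖ = ‖u + v‖ / 2 := by simp
  rw [h]
  simp only [div_pow, Complex.sq_norm, Complex.normSq_apply, Complex.add_re, Complex.add_im,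
    Complex.sub_re, Complex.sub_im]
  ring

/-- A finite set of points of the disc has a hyperbolic barycentre; it is fixed by every holomorphic
self-map of the disc that permutes the set. -/
theorem exists_mem_disc_forall_fixed {s : Finset ℂ} (hs : ∀ a ∈ s, a ∈ disc) (hne : s.Nonempty) :
    ∃ z ∈ disc, ∀ γ : ℂ → ℂ, HolDisc disc γ → MapsTo γ s s → InjOn γ s → γ z = z := by
  simp only [mem_ball_zero_iff] at hs
  have hw {a : ℂ} (ha : a ∈ s) : 0 < 1 - ‖a‖ ^ 2 := by nlinarith [hs a ha, norm_nonneg a]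
  set Q : ℂ → ℝ := fun z => ∑ a ∈ s, ‖1 - conj a * z‖ ^ 2 / (1 - ‖a‖ ^ 2) with hQ
  have hQpos {z : ℂ} (hz : ‖z‖ ≤ 1) : 0 < Q z := Finset.sum_pos (fun a ha => by
    have := norm_pos_iff.mpr (one_sub_conj_mul_ne_zero (hs a ha) hz)
    have := hw ha
    positivity) hne
  have hQc : Continuous Q := by fun_prop
  have hQconv (x y : ℂ) : Q ((x + y) / 2) ≤ (Q x + Q y) / 2 := by
    simp only [hQ]
    rw [← Finset.sum_add_distrib, Finset.sum_div]
    refine Finset.sum_le_sum fun a ha => ?_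
    have e : 1 - conj a * ((x + y) / 2) = ((1 - conj a * x) + (1 - conj a * y)) / 2 := by ring
    rw [e, norm_add_div_two_sq, ← add_div, div_right_comm]
    have := hw ha
    gcongr
    have := sq_nonneg ‖1 - conj a * x - (1 - conj a * y)‖
    linarith
  have hQψ {z : ℂ} (hz : ‖z‖ < 1) :
      Q z / (1 - ‖z‖ ^ 2) = ∑ a ∈ s, (1 - ‖mobius a z‖ ^ 2)⁻¹ := by
    rw [hQ, Finset.sum_div]
    refine Finset.sum_congr rfl fun a ha => ?_
    rw [one_sub_norm_mobius_sq (hs a ha) hz.le, inv_div, div_div]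
  -- The barycentre minimises the sum in `hQψ`, a sum of squared hyperbolic cosines of distances.
  -- Its reciprocal is maximised instead, being continuous up to the circle and zero on it.
  obtain ⟨z, hz, hmax⟩ := (isCompact_closedBall (0 : ℂ) 1).exists_isMaxOn
    (f := fun z => (1 - ‖z‖ ^ 2) / Q z) ⟨0, by simp⟩
    (ContinuousOn.div (by fun_prop) hQc.continuousOn fun z hz =>
      (hQpos (mem_closedBall_zero_iff.mp hz)).ne')
  rw [mem_closedBall_zero_iff] at hz
  set M := (1 - ‖z‖ ^ 2) / Q z with hM
  have hMle {y : ℂ} (hy : ‖y‖ ≤ 1) : (1 - ‖y‖ ^ 2) / Q y ≤ M :=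
    hmax (mem_closedBall_zero_iff.mpr hy)
  have hMpos : 0 < M := lt_of_lt_of_le (by simpa using hQpos (z := 0) (by simp))
    (hMle (y := 0) (by simp))
  have hz1 : ‖z‖ < 1 := by
    refine lt_of_le_of_ne hz fun h => ?_
    rw [hM, h] at hMpos
    simp at hMpos
  -- `Q` is convex and the squared norm strictly convex, so the midpoint of two distinct maximisers
  -- would exceed the maximum.
  have huniq {y : ℂ} (hy : ‖y‖ < 1) (hyM : M ≤ (1 - ‖y‖ ^ 2) / Q y) : y = z := by
    by_contra hyz
    have h1 : M * Q y ≤ 1 - ‖y‖ ^ 2 := (le_div_iff₀ (hQpos hy.le)).mp hyM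
    have h2 : M * Q z = 1 - ‖z‖ ^ 2 := div_mul_cancel₀ _ (hQpos hz).ne'
    have hmid : ‖(y + z) / 2‖ ≤ 1 := by
      have : ‖(y + z) / 2‖ = ‖y + z‖ / 2 := by simp
      rw [this]
      linarith [norm_add_le y z]
    have h3 : 1 - ‖(y + z) / 2‖ ^ 2 ≤ M * Q ((y + z) / 2) :=
      (div_le_iff₀ (hQpos hmid)).mp (hMle hmid)
    rw [norm_add_div_two_sq] at h3
    have h4 := mul_le_mul_of_nonneg_left (hQconv y z) hMpos.le
    have h5 : 0 < ‖y - z‖ ^ 2 := by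
      have := norm_pos_iff.mpr (sub_ne_zero.mpr hyz)
      positivity
    linarith
  refine ⟨z, mem_ball_zero_iff.mpr hz1, fun γ hγ hmaps hinj => ?_⟩
  have hγz : ‖γ z‖ < 1 := mem_ball_zero_iff.mp (hγ.2 (mem_ball_zero_iff.mpr hz1))
  refine huniq hγz ?_
  have himage : s.image γ = s := Finset.eq_of_subset_of_card_le
    (Finset.image_subset_iff.mpr fun a ha => hmaps ha) (Finset.card_image_of_injOn hinj).ge
  -- Reindexing the sum by the permutation `γ` of `s` reduces this to Schwarz–Pick in each term.
  have hle : Q (γ z) / (1 - ‖γ z‖ ^ 2) ≤ Q z / (1 - ‖z‖ ^ 2) := by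
    rw [hQψ hγz, hQψ hz1]
    conv_lhs => rw [← himage]
    rw [Finset.sum_image hinj]
    refine Finset.sum_le_sum fun a ha => ?_
    have h1 := norm_mobius_comp_le hγ (mem_ball_zero_iff.mpr (hs a ha))
      (mem_ball_zero_iff.mpr hz1)
    have h2 := norm_mobius_lt_one (hs a ha) hz1
    have h3 : 0 < 1 - ‖mobius a z‖ ^ 2 := by nlinarith [norm_nonneg (mobius a z)]
    gcongr
  have hpos : 0 < Q (γ z) / (1 - ‖γ z‖ ^ 2) :=
    div_pos (hQpos hγz.le) (by nlinarith [norm_nonneg (γ z)])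
  simpa only [inv_div] using inv_anti₀ hpos hle

/-- The deck transformation taking `a` to `b` permutes the fibre. Were the fibre finite, its
barycentre would be a fixed point, and a lift of `P` with a fixed point is the identity. -/
theorem IsHolCovering.infinite_fibre {D : Set ℂ} {P : ℂ → ℂ} (hP : IsHolCovering D P) {a b : ℂ}
    (ha : a ∈ disc) (hb : b ∈ disc) (hab : a ≠ b) (h : P a = P b) :
    {z ∈ disc | P z = P a}.Infinite := by
  intro hfin
  have hPm : MapsTo P disc D := hP.2.1
  have hpre : IsPreconnected disc := (convex_ball _ _).isPreconnected
  obtain ⟨γ, hγ, hγm, hγa, hγP⟩ := hP.exists_lift hP.1 hPm ha hb h.symm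
  obtain ⟨δ, hδ, hδm, hδb, hδP⟩ := hP.exists_lift hP.1 hPm hb ha h
  have hδγ : EqOn (δ ∘ γ) id disc := hP.eqOn_of_comp_eqOn hpre
    (hδ.continuousOn.comp hγ.continuousOn hγm) continuousOn_id (hδm.comp hγm) (mapsTo_id _)
    (fun z hz => by rw [Function.comp_apply, hδP _ (hγm hz), hγP z hz, id]) ha
    (by rw [Function.comp_apply, hγa, hδb, id])
  obtain ⟨z, hz, hfix⟩ := exists_mem_disc_forall_fixed (s := hfin.toFinset)
    (fun x hx => (hfin.mem_toFinset.mp hx).1) ⟨a, hfin.mem_toFinset.mpr ⟨ha, rfl⟩⟩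
  have hγz : γ z = z := by
    refine hfix γ ⟨hγ, hγm⟩ ?_ ?_
    · intro x hx
      have hx' := hfin.mem_toFinset.mp hx
      exact hfin.mem_toFinset.mpr ⟨hγm hx'.1, (hγP x hx'.1).trans hx'.2⟩
    · intro x hx y hy hxy
      have h1 := hδγ (hfin.mem_toFinset.mp hx).1
      have h2 := hδγ (hfin.mem_toFinset.mp hy).1
      simp only [Function.comp_apply, id] at h1 h2
      rw [← h1, ← h2, hxy]
  have hid : EqOn γ id disc := hP.eqOn_of_comp_eqOn hpre hγ.continuousOn continuousOn_id hγm
    (mapsTo_id _) hγP hz hγz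
  exact hab ((hid ha).symm.trans hγa)

/-! ### Extremals of the covered domain -/

variable {D : Set ℂ} {P f : ℂ → ℂ} {m : ℕ}

theorem holClosedDisc_const {w : ℂ} (hw : w ∈ D) : HolClosedDisc D fun _ => w :=
  ⟨univ, isOpen_univ, subset_univ _, by fun_prop, fun _ _ => hw⟩

theorem HolClosedDisc.comp {h : ℂ → ℂ} (hh : HolClosedDisc disc h) (hP : HolDisc D P) :
    HolClosedDisc D (P ∘ h) := by
  obtain ⟨U, hUo, hU, hd, hm⟩ := hh
  exact ⟨U, hUo, hU, hP.1.comp hd hm, hP.2.comp hm⟩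

theorem IsHolCovering.holDisc (hP : IsHolCovering D P) : HolDisc D P := ⟨hP.1, hP.2.1⟩

/-- Lifting needs a simply connected source, which an arbitrary neighbourhood of the closed disc
need not be. -/
theorem HolClosedDisc.exists_ball {h : ℂ → ℂ} (hh : HolClosedDisc D h) :
    ∃ R > 1, DifferentiableOn ℂ h (Metric.ball 0 R) ∧ MapsTo h (Metric.ball 0 R) D := by
  obtain ⟨U, hUo, hU, hd, hm⟩ := hh
  obtain ⟨δ, hδ, hδU⟩ := (isCompact_closedBall (0 : ℂ) 1).exists_thickening_subset_open hUo hU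
  rw [thickening_closedBall hδ zero_le_one] at hδU
  exact ⟨δ + 1, by linarith, hd.mono hδU, hm.mono_left hδU⟩

theorem IsWeakExtremal.exists_blaschkeProduct (hP : IsHolCovering D P) (hf : HolDisc D f)
    (hm : 0 < m) (h : IsWeakExtremal D m f) :
    ∃ (k : ℕ) (B : ℂ → ℂ), k ≤ m - 1 ∧ IsBlaschkeProduct k B ∧ ¬ IsConstOnDisc B ∧
      ∀ z ∈ disc, f z = P (B z) := by
  obtain ⟨l, hl, hld, -, hno⟩ := h
  have h0 : (0 : ℂ) ∈ disc := by simp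
  obtain ⟨-, hPm, -, hsurj⟩ := id hP
  obtain ⟨⟨e, he⟩, hfe⟩ := hsurj ⟨f 0, hf.2 h0⟩
  obtain ⟨g, hg, hgm, -, hgf⟩ := hP.exists_lift hf.1 hf.2 h0 he (congrArg Subtype.val hfe)
  rcases isBlaschkeProduct_or_exists_interpolation m g hg
    (fun z hz => (mem_ball_zero_iff.mp (hgm hz)).le) l hl hld with ⟨k, hk, hB⟩ | ⟨h, hh, hhl⟩
  · refine ⟨k, g, by omega, hB, ?_, fun z hz => (hgf z hz).symm⟩
    rintro ⟨c, hc⟩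
    refine hno ⟨_, holClosedDisc_const (hf.2 h0), fun j => ?_⟩
    rw [← hgf _ h0, ← hgf _ (hld j), hc _ h0, hc _ (hld j)]
  · refine absurd ⟨_, hh.comp hP.holDisc, fun j => ?_⟩ hno
    rw [Function.comp_apply, hhl j, hgf _ (hld j)]

/-- The bound is uniform in `g`, so interpolation points can be fixed before any competitor is
given. -/
theorem norm_sub_le_of_holDisc {g : ℂ → ℂ} (hg : HolDisc disc g) {z : ℂ} (hz : z ∈ disc) :
    ‖g z - g 0‖ ≤ 2 * ‖z‖ := by
  have h := Complex.dist_le_div_mul_dist_of_mapsTo_ball (R₂ := 2) hg.1 (fun w hw => ?_) hz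
  · simpa [dist_eq_norm] using h
  · have h1 := mem_ball_zero_iff.mp (hg.2 hw)
    have h2 := mem_ball_zero_iff.mp (hg.2 (x := 0) (by simp))
    rw [mem_closedBall_iff_norm]
    linarith [norm_sub_le (g w) (g 0)]

theorem isWeakExtremal_of_eq_comp_blaschkeProduct (hP : IsHolCovering D P) (hf : HolDisc D f)
    {k : ℕ} (hkm : k < m) {B : ℂ → ℂ} (hB : IsBlaschkeProduct k B) (hBc : ¬ IsConstOnDisc B)
    (hfB : ∀ z ∈ disc, f z = P (B z)) : IsWeakExtremal D m f := by
  have hBd := hB.mapsTo_disc (hB.pos_of_not_isConstOnDisc hBc)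
  have h0 : (0 : ℂ) ∈ disc := by simp
  obtain ⟨V, hV, hVd, hinj⟩ := hP.exists_nhds_injOn (hBd h0)
  obtain ⟨ε, hε, hεV⟩ := Metric.mem_nhds_iff.mp hV
  have hBcont : ContinuousAt B 0 :=
    hB.differentiableOn.continuousOn.continuousAt (Metric.isOpen_ball.mem_nhds h0)
  obtain ⟨δ, hδ, hδB⟩ := Metric.mem_nhds_iff.mp (hBcont (Metric.ball_mem_nhds _ hε))
  -- The three bounds keep the points in the disc, their images under `B` within `ε` of `B 0`, and,
  -- by the factor 2 in `norm_sub_le_of_holDisc`, those under the lift within `ε` as well.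
  set r : ℝ := min (min 1 δ) (ε / 2) with hr
  have hrpos : 0 < r := by positivity
  set l : Fin m → ℂ := fun j => ((r * (j / m : ℝ) : ℝ) : ℂ) with hl
  have hm0 : (0 : ℝ) < m := by exact_mod_cast (Nat.zero_le k).trans_lt hkm
  have hlr (j) : ‖l j‖ < r := by
    have h1 : (j : ℝ) / m < 1 := (div_lt_one hm0).mpr (by exact_mod_cast j.2)
    rw [hl, Complex.norm_real, Real.norm_of_nonneg (by positivity)]
    nlinarith
  have hld (j) : l j ∈ disc := mem_ball_zero_iff.mpr
    ((hlr j).trans_le ((min_le_left _ _).trans (min_le_left _ _)))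
  have hlinj : Function.Injective l := fun i j hij => by
    have h1 : r * (i / m : ℝ) = r * (j / m : ℝ) := Complex.ofReal_injective hij
    have h2 := mul_left_cancel₀ hrpos.ne' h1
    rw [div_left_inj' hm0.ne'] at h2
    exact Fin.ext (by exact_mod_cast h2)
  -- Having `0` among the points lets the lift of a competitor start at `B 0`.
  have hl0 : l ⟨0, by omega⟩ = 0 := by simp [hl]
  refine ⟨l, hlinj, hld, hf, ?_⟩
  rintro ⟨h, hh, hhl⟩
  obtain ⟨R, hR, hhd, hhm⟩ := hh.exists_ball
  have hRsub : disc ⊆ Metric.ball 0 R := Metric.ball_subset_ball hR.le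
  obtain ⟨g, hg, hgm, hg0, hgh⟩ := hP.exists_lift hhd hhm (hRsub h0) (hBd h0)
    (by rw [← hfB 0 h0, ← hl0, hhl])
  have hgdisc : HolDisc disc g := ⟨hg.mono hRsub, hgm.mono_left hRsub⟩
  have hgB (j) : g (l j) = B (l j) := by
    refine hinj (hεV ?_) (hεV (hδB ?_)) ?_
    · rw [mem_ball_iff_norm, ← hg0]
      have h1 := norm_sub_le_of_holDisc hgdisc (hld j)
      have h2 := (hlr j).trans_le (min_le_right _ _)
      linarith
    · exact mem_ball_zero_iff.mpr ((hlr j).trans_le ((min_le_left _ _).trans (min_le_right _ _)))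
    · rw [hgh _ (hRsub (hld j)), hhl j, hfB _ (hld j)]
  have hgc : HolClosedDisc disc g := ⟨Metric.ball 0 R, Metric.isOpen_ball,
    Metric.closedBall_subset_ball hR, hg, hgm⟩
  obtain ⟨j, hj⟩ := HolClosedDisc.not_eq_blaschkeProduct hB hgc
    (l := fun j => l (Fin.castLE hkm j)) (hlinj.comp (Fin.castLE_injective hkm)) fun j => hld _
  exact hj (hgB _)

theorem not_isExtremal_of_eq_comp_blaschkeProduct (hD : ¬ IsSimplyConnected D)
    (hP : IsHolCovering D P) {k : ℕ} {B : ℂ → ℂ} (hB : IsBlaschkeProduct k B)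
    (hBc : ¬ IsConstOnDisc B) (hfB : ∀ z ∈ disc, f z = P (B z)) : ¬ IsExtremal D m f := by
  intro hext
  obtain ⟨a, ha, b, hb, hab, hPab⟩ := hP.exists_ne_of_not_isSimplyConnected hD
  have hinf := hP.infinite_fibre ha hb hab hPab
  choose u hu huB using fun w (hw : w ∈ disc) =>
    hB.exists_eq (hB.pos_of_not_isConstOnDisc hBc) hw
  have e := hinf.natEmbedding
  set l : Fin m → ℂ := fun j => u (e j) (e j).2.1 with hl
  have hlB (j) : B (l j) = e j := huB _ _
  have hinj : Function.Injective l := fun i j hij => by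
    have h1 : (e i : ℂ) = e j := by rw [← hlB, ← hlB, hij]
    exact Fin.ext (e.injective (Subtype.ext h1))
  refine (hext l hinj fun j => hu _ _).2 ⟨fun _ => P a, holClosedDisc_const (hP.holDisc.2 ha), ?_⟩
  intro j
  rw [hfB _ (hu _ _), hlB]
  exact (e j).2.2.symm

end MExtremal

theorem mainTheorem9 (D : Set ℂ) (hD : MExtremal.IsDomain D) (hsc : ¬ IsSimplyConnected D)
    (htaut : MExtremal.IsTaut D) (P : ℂ → ℂ) (hP : MExtremal.IsHolCovering D P)
    (m : ℕ) (hm : 2 ≤ m) (f : ℂ → ℂ) (hf : MExtremal.HolDisc D f) :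
    (MExtremal.IsWeakExtremal D m f ↔
      ∃ (k : ℕ) (B : ℂ → ℂ), k ≤ m - 1 ∧ MExtremal.IsBlaschkeProduct k B ∧
        ¬ MExtremal.IsConstOnDisc B ∧ ∀ z ∈ MExtremal.disc, f z = P (B z)) ∧
    ¬ MExtremal.IsExtremal D m f := by
  have hm0 : 0 < m := by omega
  refine ⟨⟨fun h => h.exists_blaschkeProduct hP hf hm0, ?_⟩, fun hext => ?_⟩
  · rintro ⟨k, B, hk, hB, hBc, hfB⟩
    exact MExtremal.isWeakExtremal_of_eq_comp_blaschkeProduct hP hf (by omega) hB hBc hfB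
  -- The disc contains `m` distinct points, so an extremal is a weak extremal and has the form `P ∘
  -- B`.
  · have hinf : MExtremal.disc.Infinite :=
      infinite_of_mem_nhds (0 : ℂ) (Metric.ball_mem_nhds 0 one_pos)
    have e := hinf.natEmbedding
    have hinj : Function.Injective fun j : Fin m => (e j : ℂ) :=
      Subtype.val_injective.comp (e.injective.comp Fin.val_injective)
    have hweak : MExtremal.IsWeakExtremal D m f :=
      ⟨_, hinj, fun j => (e j).2, hext _ hinj fun j => (e j).2⟩
    obtain ⟨k, B, -, hB, hBc, hfB⟩ := hweak.exists_blaschkeProduct hP hf hm0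
    exact MExtremal.not_isExtremal_of_eq_comp_blaschkeProduct hsc hP hB hBc hfB hext
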